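/- Let $n\ge 1$ and let $\mathcal{Q}_n$ be the set of Stirling permutations of the multiset $\{1,1,2,2,\ldots,n,n\}$, that is, the multipermutations $\sigma=\sigma_1\sigma_2\cdots\sigma_{2n}$ of this multiset such that $\sigma_s\ge\sigma_i$ whenever $\sigma_i=\sigma_j$ and $i<s<j$. Put $\sigma_0=\sigma_{2n+1}=0$ and define \[ \begin{aligned} \mathrm{lap}(\sigma)&=\#\{1\le i\le 2n-1:\ \sigma_{i-1}<\sigma_i=\sigma_{i+1}\},\\ \mathrm{rpd}(\sigma)&=\#\{2\le i\le 2n:\ \sigma_{i-1}=\sigma_i>\sigma_{i+1}\},\\ \mathrm{eud}(\sigma)&=\#\{1\le i\le 2n-1:\ \sigma_{i-1}<\sigma_i=\sigma_j>\sigma_{j+1}\text{ for some } j \text{ with } i<j\le 2n\}. \end{aligned} \] Let $N_n(x,y,z)=\sum_{\sigma\in\mathcal{Q}_n}x^{\mathrm{lap}(\sigma)}y^{\mathrm{eud}(\sigma)}z^{\mathrm{rpd}(\sigma)}$. An increasing plane tree on $[n]=\{1,\ldots,n\}$ is a rooted tree with vertex set $[n]$ and root $1$ in which the children of each vertex are linearly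 ordered and the labels increase along every path from the root. The degree of a vertex is the number of its children, and a 0-1-2-3 increasing plane tree is an increasing plane tree in which every vertex has degree at most $3$. Let $\gamma_{n,i,j,k}$ be the number of 0-1-2-3 increasing plane trees on $[n]$ with exactly $k$ leaves (vertices of degree $0$), $j$ vertices of degree one and $i$ vertices of degree two. **Theorem.** For every $n\ge 1$, \[ N_n(x,y,z)=\sum_{i+2j+3k=2n+1}3^i\,\gamma_{n,i,j,k}\,(x+y+z)^j(xyz)^k, \] where the sum is over nonnegative integers $i,j,k$. In particular, $N_n$ is $e$-positive: it is a symmetric polynomial that can be written as a linear combination, with nonnegative real coefficients, of products $e_\mu=e_{\mu_1}e_{\mu_2}\cdots$ of elementary symmetric polynomials in $x,y,z$, where $\mu=(\mu_1,\mu_2,\ldots)$ ranges over partitions. -/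

import Mathlib

namespace StirlingPerm

/-! ### Stirling permutations and their statistics -/

/-- The entry `σ_i` of the word `σ = σ_1 σ_2 ⋯ σ_m`, with the conventions `σ_0 = 0` and
`σ_{m+1} = 0` (the default value beyond the end of the word is `0`). -/
def entry (σ : List ℕ) (i : ℕ) : ℕ := (0 :: σ).getD i 0

/-- The multiset `{1, 1, 2, 2, …, n, n}`. -/
def doubled (n : ℕ) : Multiset ℕ := 2 • (Finset.Icc 1 n).val

/-- The Stirling condition: if `σ_i = σ_j` and `i < s < j`, then `σ_s ≥ σ_i`. -/
def IsStirling (σ : List ℕ) : Prop :=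
  ∀ j ∈ Finset.Icc 1 σ.length, ∀ i ∈ Finset.Ico 1 j, ∀ s ∈ Finset.Ioo i j,
    entry σ i = entry σ j → entry σ i ≤ entry σ s

instance : DecidablePred IsStirling := fun σ => by
  unfold IsStirling
  infer_instance

/-- The set `Q_n` of Stirling permutations of `{1, 1, 2, 2, …, n, n}`: the multipermutations
of this multiset that satisfy the Stirling condition. -/
def Q (n : ℕ) : Finset (List ℕ) := (doubled n).lists.toFinset.filter IsStirling

/-- The number of left ascent-plateaux: indices `1 ≤ i ≤ m - 1` with
`σ_{i-1} < σ_i = σ_{i+1}`, where `m` is the length of `σ`. -/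
def lap (σ : List ℕ) : ℕ :=
  ((Finset.Icc 1 (σ.length - 1)).filter fun i =>
    entry σ (i - 1) < entry σ i ∧ entry σ i = entry σ (i + 1)).card

/-- The number of right plateau-descents: indices `2 ≤ i ≤ m` with
`σ_{i-1} = σ_i > σ_{i+1}`, where `m` is the length of `σ`. -/
def rpd (σ : List ℕ) : ℕ :=
  ((Finset.Icc 2 σ.length).filter fun i =>
    entry σ (i - 1) = entry σ i ∧ entry σ (i + 1) < entry σ i).card

/-- The exterior up-down-pair statistic: the number of indices `1 ≤ i ≤ m - 1` such that
`σ_{i-1} < σ_i = σ_j > σ_{j+1}` for some `j` with `i < j ≤ m`, where `m` is the length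
of `σ`. -/
def eud (σ : List ℕ) : ℕ :=
  ((Finset.Icc 1 (σ.length - 1)).filter fun i =>
    ∃ j ∈ Finset.Ioc i σ.length,
      entry σ (i - 1) < entry σ i ∧ entry σ i = entry σ j ∧
        entry σ (j + 1) < entry σ j).card

/-- The polynomial `N_n(x, y, z) = ∑_{σ ∈ Q_n} x^{lap σ} y^{eud σ} z^{rpd σ}`, where
`x, y, z` are the variables `X 0, X 1, X 2`. -/
noncomputable def N (n : ℕ) : MvPolynomial (Fin 3) ℝ :=
  ∑ σ ∈ Q n, MvPolynomial.X 0 ^ lap σ * MvPolynomial.X 1 ^ eud σ * MvPolynomial.X 2 ^ rpd σ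

/-! ### Increasing plane trees -/

/-- A rooted plane tree with vertex set `V`: every vertex has a linearly ordered list of
children, every vertex other than the root is a child of exactly one vertex, the root is a
child of none, and every vertex is reached from the root by going from parents to children. -/
structure PlaneTree (V : Type*) where
  root : V
  children : V → List V
  nodup_children : ∀ v, (children v).Nodup
  root_notMem_children : ∀ v, root ∉ children v
  existsUnique_parent : ∀ w, w ≠ root → ∃! v, w ∈ children v
  reachable : ∀ v, Relation.ReflTransGen (fun a b => b ∈ children a) root v

/-- The degree of a vertex of a rooted plane tree is the number of its children. -/
def PlaneTree.degree {V : Type*} (T : PlaneTree V) (v : V) : ℕ := (T.children v).length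

/-- Increasing plane trees on `[n]`; the element `v` of `Fin n` stands for the label `v + 1`.
The smallest label is at the root, and labels increase from parent to child, that is, along
every path that starts at the root. -/
def PlaneTree.IsIncreasing {n : ℕ} (T : PlaneTree (Fin n)) : Prop :=
  (T.root : ℕ) = 0 ∧ ∀ u v, v ∈ T.children u → u < v

/-- The number of vertices of degree `d`. -/
def PlaneTree.numDegree {n : ℕ} (T : PlaneTree (Fin n)) (d : ℕ) : ℕ :=
  (Finset.univ.filter fun v => T.degree v = d).card

/-- The 0-1-2-3 increasing plane trees on `[n]` with `k` leaves, `j` degree one vertices and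
`i` degree two vertices. -/
def trees0123 (n i j k : ℕ) : Set (PlaneTree (Fin n)) :=
  {T | T.IsIncreasing ∧ (∀ v, T.degree v ≤ 3) ∧
    T.numDegree 0 = k ∧ T.numDegree 1 = j ∧ T.numDegree 2 = i}

/-- There are only finitely many plane trees on a given finite vertex set, so that the
cardinality below is the true one. -/
theorem finite_planeTree {V : Type*} [Finite V] : Finite (PlaneTree V) := by
  classical
  have := Fintype.ofFinite V
  refine Finite.of_injective
    (fun T : PlaneTree V =>
      ((T.root, fun v => ⟨T.children v, T.nodup_children v⟩) :
        V × (V → {l : List V // l.Nodup}))) ?_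
  rintro ⟨r, c, _, _, _, _⟩ ⟨r', c', _, _, _, _⟩ h
  simp only [Prod.mk.injEq] at h
  obtain ⟨rfl, h⟩ := h
  have : c = c' := funext fun v => congrArg Subtype.val (congrFun h v)
  subst this
  rfl

/-- `γ_{n,i,j,k}`, the number of 0-1-2-3 increasing plane trees on `[n]` with `k` leaves,
`j` degree one vertices and `i` degree two vertices. -/
noncomputable def gam (n i j k : ℕ) : ℕ := (trees0123 n i j k).ncard

/-- The finite set of all triples `(i, j, k)` of nonnegative integers with
`i + 2 j + 3 k = m`. -/
def triples (m : ℕ) : Finset (ℕ × ℕ × ℕ) :=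
  (Finset.range (m + 1) ×ˢ Finset.range (m + 1) ×ˢ Finset.range (m + 1)).filter
    fun t => t.1 + 2 * t.2.1 + 3 * t.2.2 = m

/-! ### e-positivity -/

/-- A polynomial is `e`-positive if it is symmetric and is a linear combination, with
nonnegative real coefficients, of the elementary symmetric polynomials
`e_μ = e_{μ_1} e_{μ_2} ⋯` indexed by partitions `μ` of nonnegative integers. -/
def EPositive {ι : Type*} [Fintype ι] (p : MvPolynomial ι ℝ) : Prop :=
  p.IsSymmetric ∧ ∃ c : (Σ m : ℕ, m.Partition) →₀ ℝ, (∀ μ, 0 ≤ c μ) ∧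
    p = c.sum fun μ a => a • MvPolynomial.esymmPart ι ℝ μ.2

end StirlingPerm

namespace StirlingPerm

/-! ### Stirling permutations: positions of the letters -/

/-! Stirling permutations and increasing plane trees are both built by adding the largest label, and
the two growth processes are derivations that correspond to each other.

In a Stirling permutation nothing can stand between the two copies of the largest letter, so each
element of `Q (n + 1)` arises uniquely by inserting an adjacent pair into one of the 2n+1 gaps of an
element of `Q n`. For n ≥ 1, charge each gap to the larger of its two neighbours, as the slot
before, between or after the copies of that letter. An insertion fills one empty slot of one letter
and creates a letter with three empty slots (`emptySlots_insertPair`). The generating polynomial by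
sets of empty slots therefore evolves by the derivation X_E ↦ Σ_{s∈E} X_univ X_{E∖s}
(`slotPoly_succ`). The three statistics count the letters for which a given pair of slots is empty.

A new leaf can be placed in d+1 positions among the children of a vertex of degree d, so the degree
polynomial of trees evolves by X_d ↦ (d+1) X_0 X_{d+1} (`degreePoly_succ`). The substitution X_d ↦
Σ_{|E|=3-d} X_E intertwines the derivations, because a set of size 2-d comes from d+1 sets by
erasing one element (`slotDerivation_embedSlots`). Thus degree plays the role of the number of
filled slots. Weighting the sets E turns degrees 0, 1, 2, 3 into xyz, x+y+z, 3, 1 and kills higher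
degrees. Grouping trees by degree counts gives the formula; since x+y+z = e_1 and xyz = e_3, it also
gives `e`-positivity. -/

theorem mem_Q {n : ℕ} {σ : List ℕ} :
    σ ∈ Q n ↔ (∀ a, σ.count a = if 1 ≤ a ∧ a ≤ n then 2 else 0) ∧ IsStirling σ := by
  unfold Q doubled
  rw [Finset.mem_filter, Multiset.mem_toFinset, Multiset.mem_lists_iff]
  refine and_congr_left fun _ => ?_
  have key : ∀ a, Multiset.count a (2 • (Finset.Icc 1 n).val) =
      if 1 ≤ a ∧ a ≤ n then 2 else 0 := by
    intro a
    rw [Multiset.count_nsmul, Multiset.count_eq_of_nodup (Finset.Icc 1 n).nodup]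
    simp
  constructor
  · intro h a
    rw [← key, h]
    simp
  · intro h
    ext a
    rw [key, ← h]
    simp

theorem length_of_mem_Q {n : ℕ} {σ : List ℕ} (h : σ ∈ Q n) : σ.length = 2 * n := by
  unfold Q doubled at h
  rw [Finset.mem_filter, Multiset.mem_toFinset, Multiset.mem_lists_iff] at h
  have := congrArg Multiset.card h.1
  simp at this
  omega

theorem entry_succ (σ : List ℕ) (i : ℕ) : entry σ (i + 1) = σ.getD i 0 := by
  simp [entry]

@[simp] theorem entry_zero (σ : List ℕ) : entry σ 0 = 0 := by
  simp [entry]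

theorem entry_of_length_lt {σ : List ℕ} {i : ℕ} (h : σ.length < i) : entry σ i = 0 := by
  obtain ⟨j, rfl⟩ : ∃ j, i = j + 1 := ⟨i - 1, by omega⟩
  rw [entry_succ]
  exact List.getD_eq_default _ _ (by omega)

theorem entry_mem {σ : List ℕ} {i : ℕ} (h1 : 1 ≤ i) (h2 : i ≤ σ.length) : entry σ i ∈ σ := by
  obtain ⟨j, rfl⟩ : ∃ j, i = j + 1 := ⟨i - 1, by omega⟩
  rw [entry_succ, List.getD_eq_getElem _ _ (by omega)]
  exact List.getElem_mem _

theorem mem_iff_of_mem_Q {n : ℕ} {σ : List ℕ} (h : σ ∈ Q n) (a : ℕ) :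
    a ∈ σ ↔ 1 ≤ a ∧ a ≤ n := by
  rw [← List.count_pos_iff, (mem_Q.1 h).1 a]
  split_ifs with h <;> simp [h]

theorem entry_le {n : ℕ} {σ : List ℕ} (h : σ ∈ Q n) (i : ℕ) : entry σ i ≤ n := by
  by_cases h1 : 1 ≤ i ∧ i ≤ σ.length
  · exact ((mem_iff_of_mem_Q h _).1 (entry_mem h1.1 h1.2)).2
  · rcases Nat.eq_zero_or_pos i with rfl | h2
    · simp
    · rw [entry_of_length_lt (by omega)]
      omega

theorem one_le_entry {n : ℕ} {σ : List ℕ} (h : σ ∈ Q n) {i : ℕ} (h1 : 1 ≤ i) (h2 : i ≤ 2 * n) :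
    1 ≤ entry σ i :=
  ((mem_iff_of_mem_Q h _).1 (entry_mem h1 (by rw [length_of_mem_Q h]; exact h2))).1

theorem exists_append_of_count_eq_two {σ : List ℕ} {v : ℕ} (h : σ.count v = 2) :
    ∃ l₁ l₂ l₃, σ = l₁ ++ v :: (l₂ ++ v :: l₃) ∧ v ∉ l₁ ∧ v ∉ l₂ ∧ v ∉ l₃ := by
  obtain ⟨l₁, r, rfl, h1⟩ := List.eq_append_cons_of_mem (List.count_pos_iff.1 (by omega : 0 < σ.count v))
  have h2 : r.count v = 1 := by
    simpa [List.count_append, List.count_eq_zero.2 h1] using h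
  obtain ⟨l₂, l₃, rfl, h3⟩ := List.eq_append_cons_of_mem (List.count_pos_iff.1 (by omega : 0 < r.count v))
  refine ⟨l₁, l₂, l₃, rfl, h1, h3, List.count_eq_zero.1 ?_⟩
  simpa [List.count_append, List.count_eq_zero.2 h3] using h2

/-- Positivity of `v` separates it from the default value 0 at position 0 and beyond the end. -/
theorem entry_append_cons_append_cons {l₁ l₂ l₃ : List ℕ} {v : ℕ} (hv : 1 ≤ v)
    (h1 : v ∉ l₁) (h2 : v ∉ l₂) (h3 : v ∉ l₃) (i : ℕ) :
    entry (l₁ ++ v :: (l₂ ++ v :: l₃)) i = v ↔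
      i = l₁.length + 1 ∨ i = l₁.length + l₂.length + 2 := by
  rcases i with _ | i
  · simp
    omega
  rw [entry_succ, List.getD_eq_getElem?_getD]
  rcases lt_trichotomy i l₁.length with h | h | h
  · rw [List.getElem?_append_left h, List.getElem?_eq_getElem h, Option.getD_some]
    have : l₁[i] ≠ v := fun hh => h1 (hh ▸ List.getElem_mem h)
    simp only [this, false_iff]
    omega
  · subst h
    simp
  · obtain ⟨k, rfl⟩ : ∃ k, i = l₁.length + (k + 1) := ⟨i - l₁.length - 1, by omega⟩
    rw [List.getElem?_append_right (by omega), Nat.add_sub_cancel_left, List.getElem?_cons_succ]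
    rcases lt_trichotomy k l₂.length with h | h | h
    · rw [List.getElem?_append_left h, List.getElem?_eq_getElem h, Option.getD_some]
      have : l₂[k] ≠ v := fun hh => h2 (hh ▸ List.getElem_mem h)
      simp only [this, false_iff]
      omega
    · subst h
      simp
      omega
    · obtain ⟨j, rfl⟩ : ∃ j, k = l₂.length + (j + 1) := ⟨k - l₂.length - 1, by omega⟩
      rw [List.getElem?_append_right (by omega), Nat.add_sub_cancel_left, List.getElem?_cons_succ]
      have : l₃[j]?.getD 0 ≠ v := by
        by_cases hj : j < l₃.length
        · rw [List.getElem?_eq_getElem hj, Option.getD_some]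
          exact fun hh => h3 (hh ▸ List.getElem_mem hj)
        · rw [List.getElem?_eq_none (by omega), Option.getD_none]
          omega
      simp only [this, false_iff]
      omega

/-- Every letter occurs at exactly two positions, and the letters in between are larger. -/
theorem exists_positions {n : ℕ} {σ : List ℕ} (h : σ ∈ Q n) {v : ℕ} (h1 : 1 ≤ v) (h2 : v ≤ n) :
    ∃ p q, 1 ≤ p ∧ p < q ∧ q ≤ 2 * n ∧ (∀ i, entry σ i = v ↔ i = p ∨ i = q) ∧
      ∀ s, p < s → s < q → v < entry σ s := by
  have hc := (mem_Q.1 h).1 v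
  rw [if_pos ⟨h1, h2⟩] at hc
  have hl := length_of_mem_Q h
  have hS := (mem_Q.1 h).2
  obtain ⟨l₁, l₂, l₃, rfl, h3, h4, h5⟩ := exists_append_of_count_eq_two hc
  have hE := entry_append_cons_append_cons h1 h3 h4 h5
  simp only [List.length_append, List.length_cons] at hl
  refine ⟨l₁.length + 1, l₁.length + l₂.length + 2, by omega, by omega, by omega, hE, ?_⟩
  intro s hs1 hs2
  have e1 := (hE (l₁.length + 1)).2 (Or.inl rfl)
  have e2 := (hE (l₁.length + l₂.length + 2)).2 (Or.inr rfl)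
  have := hS (l₁.length + l₂.length + 2) (by simp; omega) (l₁.length + 1) (by simp) s
    (by simp; omega) (e1.trans e2.symm)
  rw [e1] at this
  refine lt_of_le_of_ne this fun hh => ?_
  have := (hE s).1 hh.symm
  omega

/-! ### Insertion of two adjacent copies of a new largest letter -/

/-- The word obtained from `σ` by inserting two adjacent letters `m` after the position `g`. -/
def insertPair (m : ℕ) (σ : List ℕ) (g : ℕ) : List ℕ := σ.take g ++ m :: m :: σ.drop g

theorem length_insertPair (m : ℕ) (σ : List ℕ) (g : ℕ) :
    (insertPair m σ g).length = σ.length + 2 := by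
  simp only [insertPair, List.length_append, List.length_cons, List.length_take, List.length_drop]
  omega

theorem count_insertPair (m : ℕ) (σ : List ℕ) (g a : ℕ) :
    (insertPair m σ g).count a = σ.count a + if a = m then 2 else 0 := by
  conv_rhs => rw [← List.take_append_drop g σ]
  simp only [insertPair, List.count_append, List.count_cons, beq_iff_eq, eq_comm (a := m)]
  split_ifs <;> omega

theorem entry_insertPair {m : ℕ} {σ : List ℕ} {g : ℕ} (hg : g ≤ σ.length) (i : ℕ) :
    entry (insertPair m σ g) i =
      if i ≤ g then entry σ i else if i ≤ g + 2 then m else entry σ (i - 2) := by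
  rcases i with _ | i
  · simp
  rw [entry_succ, List.getD_eq_getElem?_getD, insertPair]
  split_ifs with h1 h2
  · rw [List.getElem?_append_left (by simp; omega), entry_succ, List.getD_eq_getElem?_getD,
      List.getElem?_take_of_lt (by omega)]
  · rw [List.getElem?_append_right (by simp; omega)]
    have : i - (σ.take g).length = 0 ∨ i - (σ.take g).length = 1 := by simp; omega
    rcases this with h | h <;> rw [h] <;> rfl
  · obtain ⟨k, rfl⟩ : ∃ k, i = g + (k + 2) := ⟨i - g - 2, by omega⟩
    rw [List.getElem?_append_right (by rw [List.length_take]; omega),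
      show g + (k + 2) - (σ.take g).length = k + 2 by rw [List.length_take]; omega,
      show g + (k + 2) + 1 - 2 = (g + k) + 1 by omega, entry_succ, List.getD_eq_getElem?_getD]
    simp [List.getElem?_drop]

/-- The new letter exceeds all others and its copies are adjacent, so triples of positions that meet
the inserted block impose nothing. The remaining positions match those of `σ` by an increasing
shift. -/
theorem isStirling_insertPair_iff {m : ℕ} {σ : List ℕ} {g : ℕ} (hg : g ≤ σ.length)
    (hm : ∀ i, entry σ i < m) : IsStirling (insertPair m σ g) ↔ IsStirling σ := by
  have hE := entry_insertPair (m := m) hg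
  constructor
  · intro h j hj i hi s hs hij
    simp only [Finset.mem_Icc, Finset.mem_Ico, Finset.mem_Ioo] at hj hi hs
    have key : ∀ i, entry (insertPair m σ g) (if i ≤ g then i else i + 2) = entry σ i := by
      intro i
      rw [hE]
      split_ifs <;> first | rfl | omega
    have := h (if j ≤ g then j else j + 2) (by
        rw [Finset.mem_Icc, length_insertPair]; split_ifs <;> omega)
      (if i ≤ g then i else i + 2) (by rw [Finset.mem_Ico]; split_ifs <;> omega)
      (if s ≤ g then s else s + 2) (by rw [Finset.mem_Ioo]; split_ifs <;> omega)
    rw [key, key, key] at this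
    exact this hij
  · intro h j hj i hi s hs hij
    simp only [Finset.mem_Icc, Finset.mem_Ico, Finset.mem_Ioo, length_insertPair] at hj hi hs
    have key : ∀ i, ¬ (g < i ∧ i ≤ g + 2) →
        entry (insertPair m σ g) i = entry σ (if i ≤ g then i else i - 2) := by
      intro i h
      rw [hE]
      split_ifs <;> first | rfl | omega
    have key2 : ∀ i, (g < i ∧ i ≤ g + 2) → entry (insertPair m σ g) i = m := by
      intro i h
      rw [hE, if_neg (by omega), if_pos h.2]
    by_cases hi' : g < i ∧ i ≤ g + 2
    · by_cases hj' : g < j ∧ j ≤ g + 2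
      · omega
      · rw [key2 i hi', key j hj'] at hij
        exact absurd hij (hm _).ne'
    · by_cases hj' : g < j ∧ j ≤ g + 2
      · rw [key2 j hj', key i hi'] at hij
        exact absurd hij (hm _).ne
      · by_cases hs' : g < s ∧ s ≤ g + 2
        · rw [key2 s hs', key i hi']
          exact (hm _).le
        · rw [key i hi', key j hj'] at hij
          rw [key i hi', key s hs']
          refine h (if j ≤ g then j else j - 2) ?_ (if i ≤ g then i else i - 2) ?_
            (if s ≤ g then s else s - 2) ?_ hij
          · rw [Finset.mem_Icc]; split_ifs <;> omega
          · rw [Finset.mem_Ico]; split_ifs <;> omega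
          · rw [Finset.mem_Ioo]; split_ifs <;> omega

theorem insertPair_mem_Q {n : ℕ} {σ : List ℕ} (h : σ ∈ Q n) {g : ℕ} (hg : g ≤ 2 * n) :
    insertPair (n + 1) σ g ∈ Q (n + 1) := by
  rw [mem_Q, isStirling_insertPair_iff (by rw [length_of_mem_Q h]; exact hg)
    (fun i => Nat.lt_succ_of_le (entry_le h i))]
  refine ⟨fun a => ?_, (mem_Q.1 h).2⟩
  rw [count_insertPair, (mem_Q.1 h).1]
  split_ifs <;> omega

theorem exists_insertPair_eq {n : ℕ} {τ : List ℕ} (h : τ ∈ Q (n + 1)) :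
    ∃ σ ∈ Q n, ∃ g ≤ 2 * n, insertPair (n + 1) σ g = τ := by
  have hc := (mem_Q.1 h).1 (n + 1)
  rw [if_pos ⟨by omega, le_rfl⟩] at hc
  obtain ⟨l₁, l₂, l₃, rfl, h1, h2, h3⟩ := exists_append_of_count_eq_two hc
  have hE := entry_append_cons_append_cons (by omega) h1 h2 h3
  have hl₂ : l₂ = [] := by
    by_contra hne
    have hpos := List.length_pos_iff.2 hne
    have hlen := length_of_mem_Q h
    simp only [List.length_append, List.length_cons] at hlen
    have e1 := (hE (l₁.length + 1)).2 (Or.inl rfl)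
    have e2 := (hE (l₁.length + l₂.length + 2)).2 (Or.inr rfl)
    -- The position just after the first copy would hold a letter at least `n + 1`, hence a third
    -- copy.
    have := (mem_Q.1 h).2 (l₁.length + l₂.length + 2) (by simp; omega) (l₁.length + 1)
      (by simp) (l₁.length + 2) (by simp; omega) (e1.trans e2.symm)
    rw [e1] at this
    have e3 := (hE (l₁.length + 2)).1 (le_antisymm (entry_le h _) this)
    omega
  subst hl₂
  have hins : insertPair (n + 1) (l₁ ++ l₃) l₁.length = l₁ ++ (n + 1) :: ([] ++ (n + 1) :: l₃) := by
    simp [insertPair]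
  have hcount : ∀ a, (l₁ ++ l₃).count a = if 1 ≤ a ∧ a ≤ n then 2 else 0 := by
    intro a
    have := (mem_Q.1 h).1 a
    rw [← hins, count_insertPair] at this
    split_ifs at this ⊢ <;> omega
  have hm : ∀ i, entry (l₁ ++ l₃) i < n + 1 := by
    intro i
    by_cases hi : 1 ≤ i ∧ i ≤ (l₁ ++ l₃).length
    · have := entry_mem hi.1 hi.2
      rw [← List.count_pos_iff, hcount] at this
      split_ifs at this <;> omega
    · rcases Nat.eq_zero_or_pos i with rfl | h2
      · simp
      · rw [entry_of_length_lt (by omega)]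
        omega
  have hmem : l₁ ++ l₃ ∈ Q n := by
    rw [mem_Q]
    refine ⟨hcount, ?_⟩
    rw [← isStirling_insertPair_iff (by simp : l₁.length ≤ _) hm, hins]
    exact (mem_Q.1 h).2
  refine ⟨_, hmem, l₁.length, ?_, hins⟩
  rw [← length_of_mem_Q hmem]
  simp

theorem filter_insertPair {m : ℕ} {σ : List ℕ} (h : m ∉ σ) (g : ℕ) :
    (insertPair m σ g).filter (· ≠ m) = σ := by
  have : σ.filter (· ≠ m) = σ :=
    List.filter_eq_self.2 fun a ha => by simpa using fun hh : a = m => h (hh ▸ ha)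
  rw [insertPair, List.filter_append, List.filter_cons_of_neg (by simp),
    List.filter_cons_of_neg (by simp), ← List.filter_append, List.take_append_drop, this]

/-- Erasing the letter `n + 1` recovers the word, and its first occurrence, at position `g + 1`,
recovers the gap. -/
theorem insertPair_injective {n : ℕ} {σ σ' : List ℕ} (h : σ ∈ Q n) (h' : σ' ∈ Q n) {g g' : ℕ}
    (hg : g ≤ 2 * n) (hg' : g' ≤ 2 * n)
    (heq : insertPair (n + 1) σ g = insertPair (n + 1) σ' g') : σ = σ' ∧ g = g' := by
  have hσ : σ = σ' := by
    have hn : ∀ {ρ}, ρ ∈ Q n → n + 1 ∉ ρ := fun hρ hh => by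
      have := (mem_iff_of_mem_Q hρ _).1 hh
      omega
    rw [← filter_insertPair (hn h) g, heq, filter_insertPair (hn h')]
  subst hσ
  refine ⟨rfl, ?_⟩
  have hE := entry_insertPair (m := n + 1) (σ := σ) (g := g) (by rw [length_of_mem_Q h]; exact hg)
  have hE' := entry_insertPair (m := n + 1) (σ := σ) (g := g') (by rw [length_of_mem_Q h]; exact hg')
  rw [heq] at hE
  have a1 := (hE (g + 1)).symm.trans (hE' (g + 1))
  have a2 := (hE (g' + 1)).symm.trans (hE' (g' + 1))
  have b1 := entry_le h (g + 1)
  have b2 := entry_le h (g' + 1)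
  rcases lt_trichotomy g g' with hlt | rfl | hlt
  · rw [if_neg (by omega), if_pos (by omega), if_pos (by omega)] at a1
    omega
  · rfl
  · rw [if_pos (by omega), if_neg (by omega), if_pos (by omega)] at a2
    omega

theorem sum_Q_succ {M : Type*} [AddCommMonoid M] (n : ℕ) (f : List ℕ → M) :
    ∑ τ ∈ Q (n + 1), f τ =
      ∑ σ ∈ Q n, ∑ g ∈ Finset.range (2 * n + 1), f (insertPair (n + 1) σ g) := by
  rw [← Finset.sum_product']
  refine (Finset.sum_bij (fun x _ => insertPair (n + 1) x.1 x.2) ?_ ?_ ?_ fun _ _ => rfl).symm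
  · rintro ⟨σ, g⟩ h
    rw [Finset.mem_product, Finset.mem_range] at h
    exact insertPair_mem_Q h.1 (Nat.le_of_lt_succ h.2)
  · rintro ⟨σ, g⟩ h ⟨σ', g'⟩ h' heq
    rw [Finset.mem_product, Finset.mem_range] at h h'
    obtain ⟨h1, h2⟩ := insertPair_injective h.1 h'.1 (Nat.le_of_lt_succ h.2)
      (Nat.le_of_lt_succ h'.2) heq
    exact Prod.ext h1 h2
  · intro τ hτ
    obtain ⟨σ, hσ, g, hg, rfl⟩ := exists_insertPair_eq hτ
    exact ⟨(σ, g), by simp [hσ]; omega, rfl⟩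

/-! ### The kinds of the gaps of a Stirling permutation -/

/-- Which side of the larger letter the gap between adjacent letters `a` and `b` lies on:
`0` is before it, `1` between two equal letters, `2` after it. -/
def slot (a b : ℕ) : Fin 3 := if a < b then 0 else if a = b then 1 else 2

/-- The gap after the position `i`, recorded as a slot of the larger adjacent letter. -/
def kind (σ : List ℕ) (i : ℕ) : ℕ × Fin 3 :=
  (max (entry σ i) (entry σ (i + 1)), slot (entry σ i) (entry σ (i + 1)))

/-- The slots of the letter `v` that are gaps of `σ`. -/
def emptySlots (σ : List ℕ) (v : ℕ) : Finset (Fin 3) :=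
  Finset.univ.filter fun s => (v, s) ∈ (Finset.range (σ.length + 1)).image (kind σ)

theorem mem_emptySlots {σ : List ℕ} {v : ℕ} {s : Fin 3} :
    s ∈ emptySlots σ v ↔ ∃ i ≤ σ.length, kind σ i = (v, s) := by
  simp [emptySlots]

theorem kind_eq_zero_iff {σ : List ℕ} {i v : ℕ} :
    kind σ i = (v, 0) ↔ entry σ i < v ∧ entry σ (i + 1) = v := by
  rw [kind, slot, Prod.mk.injEq]
  split_ifs <;> simp <;> omega

theorem kind_eq_one_iff {σ : List ℕ} {i v : ℕ} :
    kind σ i = (v, 1) ↔ entry σ i = v ∧ entry σ (i + 1) = v := by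
  rw [kind, slot, Prod.mk.injEq]
  split_ifs <;> simp <;> omega

theorem kind_eq_two_iff {σ : List ℕ} {i v : ℕ} :
    kind σ i = (v, 2) ↔ entry σ i = v ∧ entry σ (i + 1) < v := by
  rw [kind, slot, Prod.mk.injEq]
  split_ifs <;> simp <;> omega

/-- Letters between the two copies of `v` are larger than `v`. A smaller left neighbour thus forces
the first copy and a smaller right neighbour the second, so each slot is at most one gap. -/
theorem kind_injective {n : ℕ} {σ : List ℕ} (h : σ ∈ Q n) {v : ℕ} (h1 : 1 ≤ v) (h2 : v ≤ n)
    {s : Fin 3} {i j : ℕ} (hi : kind σ i = (v, s)) (hj : kind σ j = (v, s)) : i = j := by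
  obtain ⟨p, q, hp, hpq, hq, hE, hb⟩ := exists_positions h h1 h2
  have key : s = 0 ∨ s = 1 ∨ s = 2 := by fin_cases s <;> simp
  rcases key with rfl | rfl | rfl
  · rw [kind_eq_zero_iff, hE] at hi hj
    have key : ∀ i, entry σ i < v → (i + 1 = p ∨ i + 1 = q) → i + 1 = p := by
      rintro i h1 (h2 | h2)
      · exact h2
      · have h3 : ¬ (i = p ∨ i = q) := fun hh => h1.ne ((hE i).2 hh)
        have := hb i (by omega) (by omega)
        omega
    have := key i hi.1 hi.2
    have := key j hj.1 hj.2
    omega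
  · rw [kind_eq_one_iff, hE, hE] at hi hj
    omega
  · rw [kind_eq_two_iff, hE] at hi hj
    have key : ∀ i, entry σ (i + 1) < v → (i = p ∨ i = q) → i = q := by
      rintro i h1 (h2 | h2)
      · have h3 : ¬ (i + 1 = p ∨ i + 1 = q) := fun hh => h1.ne ((hE _).2 hh)
        have := hb (i + 1) (by omega) (by omega)
        omega
      · exact h2
    have := key i hi.2 hi.1
    have := key j hj.2 hj.1
    omega

theorem kind_fst_mem {n : ℕ} (hn : 1 ≤ n) {σ : List ℕ} (h : σ ∈ Q n) {i : ℕ} (hi : i ≤ 2 * n) :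
    1 ≤ (kind σ i).1 ∧ (kind σ i).1 ≤ n := by
  refine ⟨?_, max_le (entry_le h _) (entry_le h _)⟩
  rcases Nat.eq_zero_or_pos i with rfl | h0
  · exact le_max_of_le_right (one_le_entry h (by omega) (by omega))
  · exact le_max_of_le_left (one_le_entry h h0 hi)

theorem kind_injOn {n : ℕ} (hn : 1 ≤ n) {σ : List ℕ} (h : σ ∈ Q n) :
    Set.InjOn (kind σ) (Finset.range (2 * n + 1)) := by
  intro i hi j _ hij
  simp only [Finset.coe_range, Set.mem_Iio] at hi
  have := kind_fst_mem hn h (Nat.le_of_lt_succ hi)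
  exact kind_injective h this.1 this.2 (s := (kind σ i).2) rfl hij.symm

section Insertion

variable {n : ℕ} {σ : List ℕ} {g : ℕ}

theorem kind_insertPair (h : σ ∈ Q n) (hg : g ≤ 2 * n) (i : ℕ) :
    kind (insertPair (n + 1) σ g) i =
      if i < g then kind σ i
      else if i = g then (n + 1, 0) else if i = g + 1 then (n + 1, 1)
      else if i = g + 2 then (n + 1, 2) else kind σ (i - 2) := by
  have hE := entry_insertPair (m := n + 1) (σ := σ) (g := g) (by rw [length_of_mem_Q h]; exact hg)
  have h1 := entry_le h
  split_ifs with a1 a2 a3 a4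
  · rw [kind, kind, hE, hE, if_pos (by omega), if_pos (by omega)]
  · rw [kind_eq_zero_iff, hE, hE, if_pos (by omega), if_neg (by omega), if_pos (by omega)]
    exact ⟨Nat.lt_succ_of_le (h1 _), rfl⟩
  · rw [kind_eq_one_iff, hE, hE, if_neg (by omega), if_pos (by omega), if_neg (by omega),
      if_pos (by omega)]
    exact ⟨rfl, rfl⟩
  · rw [kind_eq_two_iff, hE, hE, if_neg (by omega), if_pos (by omega), if_neg (by omega),
      if_neg (by omega)]
    exact ⟨rfl, Nat.lt_succ_of_le (h1 _)⟩
  · rw [kind, kind, hE, hE, if_neg (by omega), if_neg (by omega), if_neg (by omega),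
      if_neg (by omega), show i + 1 - 2 = i - 2 + 1 by omega]

theorem emptySlots_insertPair_self (h : σ ∈ Q n) (hg : g ≤ 2 * n) :
    emptySlots (insertPair (n + 1) σ g) (n + 1) = Finset.univ := by
  ext s
  simp only [Finset.mem_univ, iff_true, mem_emptySlots, length_insertPair, length_of_mem_Q h]
  refine ⟨g + s, by omega, ?_⟩
  rw [kind_insertPair h hg]
  fin_cases s <;> simp

/-- The gap `g` is replaced by three gaps charged to `n + 1`, and all other gaps keep their kind. By
`kind_injective` no other gap can supply the slot that is lost. -/
theorem emptySlots_insertPair (h : σ ∈ Q n) (hg : g ≤ 2 * n) {v : ℕ} (h1 : 1 ≤ v) (h2 : v ≤ n) :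
    emptySlots (insertPair (n + 1) σ g) v =
      if v = (kind σ g).1 then (emptySlots σ v).erase (kind σ g).2 else emptySlots σ v := by
  have key : ∀ s, s ∈ emptySlots (insertPair (n + 1) σ g) v ↔
      (v, s) ≠ kind σ g ∧ s ∈ emptySlots σ v := by
    intro s
    simp only [mem_emptySlots, length_insertPair, length_of_mem_Q h]
    have hv : ∀ c : Fin 3, ¬ ((n + 1, c) : ℕ × Fin 3) = (v, s) := by
      intro c hc
      have := congrArg Prod.fst hc
      simp only at this
      omega
    constructor
    · rintro ⟨i, hi, hk⟩
      rw [kind_insertPair h hg] at hk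
      have : ∃ j ≤ 2 * n, j ≠ g ∧ kind σ j = (v, s) := by
        split_ifs at hk with a1 a2 a3 a4
        · exact ⟨i, by omega, by omega, hk⟩
        · exact absurd hk (hv _)
        · exact absurd hk (hv _)
        · exact absurd hk (hv _)
        · exact ⟨i - 2, by omega, by omega, hk⟩
      obtain ⟨j, hj, hjg, hk⟩ := this
      exact ⟨fun hh => hjg (kind_injective h h1 h2 hk hh.symm), j, hj, hk⟩
    · rintro ⟨hne, j, hj, hk⟩
      have hjg : j ≠ g := fun hh => hne (by rw [← hk, hh])
      -- Gaps to the right of `g` move by the two inserted letters.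
      refine ⟨if j < g then j else j + 2, by split_ifs <;> omega, ?_⟩
      rw [kind_insertPair h hg]
      by_cases hlt : j < g
      · rw [if_pos hlt, if_pos hlt, hk]
      · rw [if_neg hlt, if_neg (by omega), if_neg (by omega), if_neg (by omega),
          if_neg (by omega), Nat.add_sub_cancel, hk]
  ext s
  rw [key]
  split_ifs with hv
  · rw [Finset.mem_erase]
    subst hv
    refine and_congr_left fun _ => not_congr ⟨fun hh => congrArg Prod.snd hh, fun hh => by rw [hh]⟩
  · refine and_iff_right fun hh => hv (congrArg Prod.fst hh)

end Insertion

/-! ### The statistics in terms of empty slots -/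

theorem zero_mem_emptySlots_iff {σ : List ℕ} {v : ℕ} :
    0 ∈ emptySlots σ v ↔ ∃ i, i ≤ σ.length ∧ entry σ i < v ∧ entry σ (i + 1) = v := by
  simp only [mem_emptySlots, kind_eq_zero_iff]

theorem one_mem_emptySlots_iff {σ : List ℕ} {v : ℕ} :
    1 ∈ emptySlots σ v ↔ ∃ i, i ≤ σ.length ∧ entry σ i = v ∧ entry σ (i + 1) = v := by
  simp only [mem_emptySlots, kind_eq_one_iff]

theorem two_mem_emptySlots_iff {σ : List ℕ} {v : ℕ} :
    2 ∈ emptySlots σ v ↔ ∃ i, i ≤ σ.length ∧ entry σ i = v ∧ entry σ (i + 1) < v := by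
  simp only [mem_emptySlots, kind_eq_two_iff]

/-- Reading off the letter at a counted position is a bijection onto the letters with these two
slots empty: the position must be that of the first copy. -/
theorem lap_eq_card {n : ℕ} {σ : List ℕ} (h : σ ∈ Q n) :
    lap σ = ((Finset.Icc 1 n).filter fun v => 0 ∈ emptySlots σ v ∧ 1 ∈ emptySlots σ v).card := by
  have hl := length_of_mem_Q h
  refine Finset.card_bij (fun i _ => entry σ i) ?_ ?_ ?_
  · intro i hi
    rw [Finset.mem_filter, Finset.mem_Icc] at hi
    rw [Finset.mem_filter, Finset.mem_Icc, zero_mem_emptySlots_iff, one_mem_emptySlots_iff]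
    refine ⟨⟨by omega, entry_le h i⟩, ⟨i - 1, by omega, hi.2.1, by rw [Nat.sub_add_cancel hi.1.1]⟩,
      i, by omega, rfl, hi.2.2.symm⟩
  · intro i hi j hj hij
    rw [Finset.mem_filter, Finset.mem_Icc] at hi hj
    exact kind_injective h (v := entry σ i) (by omega) (entry_le h i)
      (kind_eq_one_iff.2 ⟨rfl, hi.2.2.symm⟩) (kind_eq_one_iff.2 ⟨hij.symm, by rw [← hj.2.2, hij]⟩)
  · intro v hv
    rw [Finset.mem_filter, Finset.mem_Icc, zero_mem_emptySlots_iff, one_mem_emptySlots_iff] at hv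
    obtain ⟨⟨h1, h2⟩, ⟨i, hi, hi1, hi2⟩, j, hj, hj1, hj2⟩ := hv
    obtain ⟨p, q, hp, hpq, hq, hE, hb⟩ := exists_positions h h1 h2
    have e1 := (hE _).1 hi2
    have e2 := (hE _).1 hj1
    have e3 := (hE _).1 hj2
    have e4 : ¬ (i = p ∨ i = q) := fun hh => hi1.ne ((hE i).2 hh)
    refine ⟨j, ?_, hj1⟩
    rw [Finset.mem_filter, Finset.mem_Icc, hj1, hj2, show j - 1 = i by omega]
    exact ⟨by omega, hi1, rfl⟩

theorem rpd_eq_card {n : ℕ} {σ : List ℕ} (h : σ ∈ Q n) :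
    rpd σ = ((Finset.Icc 1 n).filter fun v => 1 ∈ emptySlots σ v ∧ 2 ∈ emptySlots σ v).card := by
  have hl := length_of_mem_Q h
  refine Finset.card_bij (fun i _ => entry σ i) ?_ ?_ ?_
  · intro i hi
    rw [Finset.mem_filter, Finset.mem_Icc] at hi
    rw [Finset.mem_filter, Finset.mem_Icc, one_mem_emptySlots_iff, two_mem_emptySlots_iff]
    refine ⟨⟨by omega, entry_le h i⟩, ⟨i - 1, by omega, hi.2.1,
      by rw [Nat.sub_add_cancel (by omega)]⟩, i, by omega, rfl, hi.2.2⟩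
  · intro i hi j hj hij
    rw [Finset.mem_filter, Finset.mem_Icc] at hi hj
    exact kind_injective h (v := entry σ i) (by omega) (entry_le h i)
      (kind_eq_two_iff.2 ⟨rfl, hi.2.2⟩) (kind_eq_two_iff.2 ⟨hij.symm, hij ▸ hj.2.2⟩)
  · intro v hv
    rw [Finset.mem_filter, Finset.mem_Icc, one_mem_emptySlots_iff, two_mem_emptySlots_iff] at hv
    obtain ⟨⟨h1, h2⟩, ⟨i, hi, hi1, hi2⟩, j, hj, hj1, hj2⟩ := hv
    obtain ⟨p, q, hp, hpq, hq, hE, hb⟩ := exists_positions h h1 h2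
    have e1 := (hE _).1 hi1
    have e2 := (hE _).1 hi2
    have e3 := (hE _).1 hj1
    have e4 : ¬ (j + 1 = p ∨ j + 1 = q) := fun hh => hj2.ne ((hE _).2 hh)
    refine ⟨j, ?_, hj1⟩
    rw [Finset.mem_filter, Finset.mem_Icc, hj1, show j - 1 = i by omega, hi1]
    exact ⟨by omega, rfl, hj2⟩

theorem eud_eq_card {n : ℕ} {σ : List ℕ} (h : σ ∈ Q n) :
    eud σ = ((Finset.Icc 1 n).filter fun v => 0 ∈ emptySlots σ v ∧ 2 ∈ emptySlots σ v).card := by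
  have hl := length_of_mem_Q h
  refine Finset.card_bij (fun i _ => entry σ i) ?_ ?_ ?_
  · intro i hi
    rw [Finset.mem_filter, Finset.mem_Icc] at hi
    obtain ⟨hi, j, hj, h1, h2, h3⟩ := hi
    rw [Finset.mem_Ioc] at hj
    rw [Finset.mem_filter, Finset.mem_Icc, zero_mem_emptySlots_iff, two_mem_emptySlots_iff]
    exact ⟨⟨by omega, entry_le h i⟩, ⟨i - 1, by omega, h1, by rw [Nat.sub_add_cancel hi.1]⟩,
      j, hj.2, h2.symm, h2 ▸ h3⟩
  · intro i hi j hj hij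
    rw [Finset.mem_filter, Finset.mem_Icc] at hi hj
    obtain ⟨hi, _, _, hi1, _⟩ := hi
    obtain ⟨hj, _, _, hj1, _⟩ := hj
    have := kind_injective h (v := entry σ i) (i := i - 1) (j := j - 1) (by omega) (entry_le h i)
      (kind_eq_zero_iff.2 ⟨hi1, by rw [Nat.sub_add_cancel hi.1]⟩)
      (kind_eq_zero_iff.2 ⟨hij ▸ hj1, by rw [Nat.sub_add_cancel hj.1, hij]⟩)
    omega
  · intro v hv
    rw [Finset.mem_filter, Finset.mem_Icc, zero_mem_emptySlots_iff, two_mem_emptySlots_iff] at hv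
    obtain ⟨⟨h1, h2⟩, ⟨i, hi, hi1, hi2⟩, j, hj, hj1, hj2⟩ := hv
    obtain ⟨p, q, hp, hpq, hq, hE, hb⟩ := exists_positions h h1 h2
    have e1 := (hE _).1 hi2
    have e3 := (hE _).1 hj1
    have e2 : ¬ (i = p ∨ i = q) := fun hh => hi1.ne ((hE _).2 hh)
    have e4 : ¬ (j + 1 = p ∨ j + 1 = q) := fun hh => hj2.ne ((hE _).2 hh)
    -- Otherwise position `i` would lie strictly between the copies and hold a letter larger than
    -- `v`; symmetrically for `j + 1` below.
    have e5 : i + 1 = p := by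
      by_contra hne
      have := hb i (by omega) (by omega)
      omega
    have e6 : j = q := by
      by_contra hne
      have := hb (j + 1) (by omega) (by omega)
      omega
    refine ⟨i + 1, ?_, hi2⟩
    rw [Finset.mem_filter, Finset.mem_Icc, hi2, Nat.add_sub_cancel]
    refine ⟨by omega, j, by rw [Finset.mem_Ioc]; omega, hi1, hj1.symm, by rw [hj1]; exact hj2⟩

/-! ### Increasing plane trees as child functions -/

/-- The functions `c` that give the ordered lists of children in an increasing plane tree with
vertices `0, …, n - 1`. -/
structure IsIncreasingChildren (n : ℕ) (c : ℕ → List ℕ) : Prop where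
  nodup : ∀ u, (c u).Nodup
  lt : ∀ u, ∀ v ∈ c u, u < v ∧ v < n
  existsUnique : ∀ w, 0 < w → w < n → ∃! u, w ∈ c u

/-- Add the new vertex `n` as the child of `v` at position `p`. -/
def insertLeaf (n : ℕ) (c : ℕ → List ℕ) (v p : ℕ) : ℕ → List ℕ :=
  Function.update c v ((c v).take p ++ n :: (c v).drop p)

theorem mem_insertLeaf {n : ℕ} {c : ℕ → List ℕ} {v p u w : ℕ} :
    w ∈ insertLeaf n c v p u ↔ w ∈ c u ∨ (u = v ∧ w = n) := by
  unfold insertLeaf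
  by_cases h : u = v
  · subst h
    have : w ∈ c u ↔ w ∈ (c u).take p ∨ w ∈ (c u).drop p := by
      rw [← List.mem_append, List.take_append_drop]
    rw [Function.update_self, List.mem_append, List.mem_cons, this]
    tauto
  · rw [Function.update_of_ne h]
    tauto

theorem length_insertLeaf (n : ℕ) (c : ℕ → List ℕ) (v p u : ℕ) :
    (insertLeaf n c v p u).length = if u = v then (c u).length + 1 else (c u).length := by
  unfold insertLeaf
  split_ifs with h
  · subst h
    simp only [Function.update_self, List.length_append, List.length_cons, List.length_take,
      List.length_drop]
    omega
  · rw [Function.update_of_ne h]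

namespace IsIncreasingChildren

variable {n : ℕ} {c : ℕ → List ℕ}

theorem notMem (h : IsIncreasingChildren n c) (u : ℕ) : n ∉ c u :=
  fun hh => (h.lt u n hh).2.false

theorem eq_nil (h : IsIncreasingChildren n c) {u : ℕ} (hu : n ≤ u + 1) : c u = [] :=
  List.eq_nil_iff_forall_not_mem.2 fun v hv => by
    have := h.lt u v hv
    omega

theorem eq_of_le_one (h : IsIncreasingChildren n c) (hn : n ≤ 1) : c = fun _ => [] :=
  funext fun _ => h.eq_nil (by omega)

theorem insertLeaf (h : IsIncreasingChildren n c) {v : ℕ} (hv : v < n) (p : ℕ) :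
    IsIncreasingChildren (n + 1) (insertLeaf n c v p) where
  nodup u := by
    unfold StirlingPerm.insertLeaf
    by_cases hu : u = v
    · subst hu
      rw [Function.update_self, List.nodup_middle, List.take_append_drop, List.nodup_cons]
      exact ⟨h.notMem u, h.nodup u⟩
    · rw [Function.update_of_ne hu]
      exact h.nodup u
  lt u w hw := by
    rcases mem_insertLeaf.1 hw with hw | ⟨rfl, rfl⟩
    · have := h.lt u w hw
      omega
    · omega
  existsUnique w h0 hw := by
    simp only [mem_insertLeaf]
    rcases Nat.lt_succ_iff_lt_or_eq.1 hw with hw | rfl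
    · obtain ⟨u, hu, huu⟩ := h.existsUnique w h0 hw
      refine ⟨u, Or.inl hu, ?_⟩
      rintro y (hy | ⟨_, rfl⟩)
      · exact huu y hy
      · omega
    · refine ⟨v, Or.inr ⟨rfl, rfl⟩, ?_⟩
      rintro y (hy | hy)
      · exact absurd hy (h.notMem y)
      · exact hy.1

theorem insertLeaf_injective {c' : ℕ → List ℕ} (h : IsIncreasingChildren n c)
    (h' : IsIncreasingChildren n c') {v v' p p' : ℕ} (hp : p ≤ (c v).length)
    (hp' : p' ≤ (c' v').length)
    (heq : StirlingPerm.insertLeaf n c v p = StirlingPerm.insertLeaf n c' v' p') :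
    c = c' ∧ v = v' ∧ p = p' := by
  have hv : v = v' := by
    have : n ∈ StirlingPerm.insertLeaf n c' v' p' v := heq ▸ mem_insertLeaf.2 (Or.inr ⟨rfl, rfl⟩)
    rcases mem_insertLeaf.1 this with h1 | h1
    · exact absurd h1 (h'.notMem v)
    · exact h1.1
  subst hv
  have hu := congrFun heq v
  unfold StirlingPerm.insertLeaf at hu
  rw [Function.update_self, Function.update_self] at hu
  obtain ⟨e1, -, e2⟩ := (List.append_cons_inj_of_notMem
    (fun hh => h.notMem v (List.mem_of_mem_take hh))
    (fun hh => h.notMem v (List.mem_of_mem_drop hh))).1 hu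
  refine ⟨funext fun u => ?_, rfl, ?_⟩
  · by_cases huv : u = v
    · subst huv
      rw [← List.take_append_drop p (c u), e1, e2, List.take_append_drop]
    · have := congrFun heq u
      unfold StirlingPerm.insertLeaf at this
      rwa [Function.update_of_ne huv, Function.update_of_ne huv] at this
  · have := congrArg List.length e1
    simp only [List.length_take] at this
    omega

/-- The largest vertex `n` is always a leaf and, as `n ≥ 1`, has a parent. Deleting it from the list
of that parent inverts the insertion. -/
theorem exists_insertLeaf_eq (hn : 1 ≤ n) (h : IsIncreasingChildren (n + 1) c) :
    ∃ c', IsIncreasingChildren n c' ∧ ∃ v < n, ∃ p ≤ (c' v).length,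
      StirlingPerm.insertLeaf n c' v p = c := by
  obtain ⟨v, hv, hvu⟩ := h.existsUnique n (by omega) (by omega)
  obtain ⟨l₁, l₂, hl, -⟩ := List.eq_append_cons_of_mem hv
  have hnd := h.nodup v
  rw [hl, List.nodup_middle, List.nodup_cons] at hnd
  have hmem : ∀ u w, w ∈ Function.update c v (l₁ ++ l₂) u ↔ w ∈ c u ∧ w ≠ n := by
    intro u w
    by_cases hu : u = v
    · subst hu
      rw [Function.update_self, hl, List.mem_append, List.mem_append, List.mem_cons]
      constructor
      · intro hw
        refine ⟨by tauto, ?_⟩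
        rintro rfl
        exact hnd.1 (List.mem_append.2 hw)
      · tauto
    · rw [Function.update_of_ne hu]
      refine ⟨fun hw => ⟨hw, ?_⟩, fun hw => hw.1⟩
      rintro rfl
      exact hu (hvu u hw)
  refine ⟨Function.update c v (l₁ ++ l₂), ⟨fun u => ?_, fun u w hw => ?_, fun w h0 hw => ?_⟩, v,
    (h.lt v n hv).1, l₁.length, by simp, ?_⟩
  · by_cases hu : u = v
    · subst hu
      rw [Function.update_self]
      exact hnd.2
    · rw [Function.update_of_ne hu]
      exact h.nodup u
  · rw [hmem] at hw
    have := h.lt u w hw.1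
    omega
  · simp only [hmem]
    obtain ⟨u, hu, huu⟩ := h.existsUnique w h0 (by omega)
    exact ⟨u, ⟨hu, by omega⟩, fun y hy => huu y hy.1⟩
  · funext u
    unfold StirlingPerm.insertLeaf
    by_cases hu : u = v
    · subst hu
      simp [hl]
    · rw [Function.update_of_ne hu, Function.update_of_ne hu]

end IsIncreasingChildren

theorem finite_isIncreasingChildren (n : ℕ) : {c | IsIncreasingChildren n c}.Finite := by
  induction n with
  | zero => exact (Set.finite_singleton (fun _ => [])).subset fun c hc => hc.eq_of_le_one (by omega)
  | succ n ih =>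
    rcases Nat.eq_zero_or_pos n with rfl | hn
    · exact (Set.finite_singleton (fun _ => [])).subset fun c hc => hc.eq_of_le_one (by omega)
    · refine (ih.biUnion fun c _ => (Set.finite_Iio n).biUnion fun v _ =>
        (Set.finite_Iic (c v).length).image (insertLeaf n c v)).subset fun c hc => ?_
      obtain ⟨c', hc', v, hv, p, hp, rfl⟩ := hc.exists_insertLeaf_eq hn
      simp only [Set.mem_iUnion]
      exact ⟨c', hc', v, hv, p, hp, rfl⟩

/-- The finite set of child functions of increasing plane trees with vertices `0, …, n - 1`. -/
noncomputable def increasingChildren (n : ℕ) : Finset (ℕ → List ℕ) :=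
  (finite_isIncreasingChildren n).toFinset

theorem mem_increasingChildren {n : ℕ} {c : ℕ → List ℕ} :
    c ∈ increasingChildren n ↔ IsIncreasingChildren n c := by
  simp [increasingChildren]

theorem increasingChildren_one : increasingChildren 1 = {fun _ => []} := by
  ext c
  rw [mem_increasingChildren, Finset.mem_singleton]
  refine ⟨fun h => h.eq_of_le_one le_rfl, ?_⟩
  rintro rfl
  exact ⟨fun _ => List.nodup_nil, fun _ _ h => absurd h List.not_mem_nil, fun w _ _ => by omega⟩

theorem sum_increasingChildren_succ {M : Type*} [AddCommMonoid M] {n : ℕ} (hn : 1 ≤ n)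
    (f : (ℕ → List ℕ) → M) :
    ∑ c ∈ increasingChildren (n + 1), f c =
      ∑ c ∈ increasingChildren n, ∑ v ∈ Finset.range n, ∑ p ∈ Finset.range ((c v).length + 1),
        f (insertLeaf n c v p) := by
  simp_rw [Finset.sum_sigma']
  refine (Finset.sum_bij (fun x _ => insertLeaf n x.1 x.2.1 x.2.2) ?_ ?_ ?_ fun _ _ => rfl).symm
  · rintro ⟨c, v, p⟩ h
    simp only [Finset.mem_sigma, mem_increasingChildren, Finset.mem_range] at h ⊢
    exact h.1.insertLeaf h.2.1 p
  · rintro ⟨c, v, p⟩ h ⟨c', v', p'⟩ h' heq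
    simp only [Finset.mem_sigma, mem_increasingChildren, Finset.mem_range, Nat.lt_succ_iff] at h h'
    obtain ⟨rfl, rfl, rfl⟩ := h.1.insertLeaf_injective h'.1 h.2.2 h'.2.2 heq
    rfl
  · intro c hc
    obtain ⟨c', hc', v, hv, p, hp, rfl⟩ :=
      (mem_increasingChildren.1 hc).exists_insertLeaf_eq hn
    refine ⟨⟨c', v, p⟩, ?_, rfl⟩
    simp only [Finset.mem_sigma, mem_increasingChildren, Finset.mem_range, Nat.lt_succ_iff]
    exact ⟨hc', hv, hp⟩

/-- The child function of a plane tree on `Fin n`, with natural numbers as vertices. -/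
def PlaneTree.natChildren {n : ℕ} (T : PlaneTree (Fin n)) (u : ℕ) : List ℕ :=
  if h : u < n then (T.children ⟨u, h⟩).map Fin.val else []

namespace PlaneTree

variable {n : ℕ}

theorem natChildren_val (T : PlaneTree (Fin n)) (u : Fin n) :
    T.natChildren u = (T.children u).map Fin.val := by
  simp [natChildren]

theorem length_natChildren (T : PlaneTree (Fin n)) (u : Fin n) :
    (T.natChildren u).length = T.degree u := by
  rw [natChildren_val, List.length_map, degree]

theorem mem_natChildren {T : PlaneTree (Fin n)} {u w : ℕ} :
    w ∈ T.natChildren u ↔ ∃ (hu : u < n) (hw : w < n), (⟨w, hw⟩ : Fin n) ∈ T.children ⟨u, hu⟩ := by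
  unfold natChildren
  split_ifs with h
  · rw [List.mem_map]
    constructor
    · rintro ⟨a, ha, rfl⟩
      exact ⟨h, a.2, ha⟩
    · rintro ⟨_, hw, ha⟩
      exact ⟨_, ha, rfl⟩
  · simp [h]

theorem isIncreasingChildren_natChildren {T : PlaneTree (Fin n)} (h : T.IsIncreasing) :
    IsIncreasingChildren n T.natChildren where
  nodup u := by
    unfold natChildren
    split_ifs
    · exact (T.nodup_children _).map Fin.val_injective
    · exact List.nodup_nil
  lt u w hw := by
    obtain ⟨hu, hw, hm⟩ := mem_natChildren.1 hw
    exact ⟨h.2 _ _ hm, hw⟩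
  existsUnique w h0 hw := by
    obtain ⟨v, hv, hvu⟩ := T.existsUnique_parent ⟨w, hw⟩ fun hh => by
      have := congrArg Fin.val hh
      rw [h.1] at this
      exact h0.ne' this
    refine ⟨v, mem_natChildren.2 ⟨v.2, hw, hv⟩, fun y hy => ?_⟩
    obtain ⟨hu, _, hm⟩ := mem_natChildren.1 hy
    exact congrArg Fin.val (hvu _ hm)

theorem natChildren_injective {T T' : PlaneTree (Fin n)} (h : T.IsIncreasing)
    (h' : T'.IsIncreasing) (heq : T.natChildren = T'.natChildren) : T = T' := by
  have hr : T.root = T'.root := Fin.ext (h.1.trans h'.1.symm)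
  have hc : T.children = T'.children := by
    funext u
    have := congrFun heq u
    rw [natChildren_val, natChildren_val] at this
    exact List.map_injective_iff.2 Fin.val_injective this
  cases T
  cases T'
  simp only at hr hc
  subst hr hc
  rfl

/-- Reachability need not be assumed of a child function: parents have smaller labels, so strong
induction on the label leads back to the root. -/
theorem exists_natChildren_eq (hn : 1 ≤ n) {c : ℕ → List ℕ} (h : IsIncreasingChildren n c) :
    ∃ T : PlaneTree (Fin n), T.IsIncreasing ∧ T.natChildren = c := by
  let ch : Fin n → List (Fin n) := fun u => (c u).pmap Fin.mk fun v hv => (h.lt u v hv).2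
  have hch : ∀ u v : Fin n, v ∈ ch u ↔ (v : ℕ) ∈ c u := by
    intro u v
    simp only [ch, List.mem_pmap]
    constructor
    · rintro ⟨a, ha, rfl⟩
      exact ha
    · intro hv
      exact ⟨v, hv, rfl⟩
  have hmap : ∀ u, (ch u).map Fin.val = c u := by
    intro u
    simp [ch, List.map_pmap]
  have hpar : ∀ w : Fin n, w ≠ ⟨0, hn⟩ → ∃! v, w ∈ ch v := by
    intro w hw
    have h0 : 0 < (w : ℕ) := Nat.pos_of_ne_zero fun hh => hw (Fin.ext hh)
    obtain ⟨u, hu, huu⟩ := h.existsUnique w h0 w.2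
    exact ⟨⟨u, (h.lt u w hu).1.trans w.2⟩, (hch _ _).2 hu,
      fun y hy => Fin.ext (huu y ((hch _ _).1 hy))⟩
  refine ⟨⟨⟨0, hn⟩, ch, fun u => ?_, fun u hu => ?_, hpar, fun v => ?_⟩, ⟨rfl, fun u v hv => ?_⟩,
    funext fun u => ?_⟩
  · refine List.Nodup.of_map Fin.val ?_
    rw [hmap]
    exact h.nodup u
  · exact absurd (h.lt _ _ ((hch _ _).1 hu)).1 (Nat.not_lt_zero _)
  · obtain ⟨v, hv⟩ := v
    induction v using Nat.strong_induction_on with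
    | _ v ih =>
      by_cases h0 : (⟨v, hv⟩ : Fin n) = ⟨0, hn⟩
      · rw [h0]
      · obtain ⟨u, hu, -⟩ := hpar _ h0
        exact (ih u (h.lt _ _ ((hch _ _).1 hu)).1 u.2).tail hu
  · exact (h.lt _ _ ((hch _ _).1 hv)).1
  · unfold natChildren
    split_ifs with hu
    · exact hmap ⟨u, hu⟩
    · exact (h.eq_nil (by omega)).symm

end PlaneTree

/-! ### The generating polynomials and their derivations -/

theorem leibniz_finset_prod {R A ι : Type*} [CommSemiring R] [CommSemiring A] [Algebra R A]
    [DecidableEq ι] (D : Derivation R A A) (s : Finset ι) (f : ι → A) :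
    D (∏ i ∈ s, f i) = ∑ i ∈ s, (∏ j ∈ s.erase i, f j) * D (f i) := by
  induction s using Finset.induction_on with
  | empty => simp
  | insert a s ha ih =>
    rw [Finset.prod_insert ha, D.leibniz, ih, Finset.sum_insert ha, Finset.erase_insert ha,
      smul_eq_mul, smul_eq_mul, Finset.mul_sum, add_comm]
    congr 1
    refine Finset.sum_congr rfl fun i hi => ?_
    have hia : a ≠ i := fun h => ha (h ▸ hi)
    rw [Finset.erase_insert_of_ne hia, Finset.prod_insert (fun h => ha (Finset.mem_of_mem_erase h)),
      mul_assoc]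

/-- The generating polynomial of Stirling permutations by the sets of empty slots. -/
noncomputable def slotPoly (n : ℕ) : MvPolynomial (Finset (Fin 3)) ℝ :=
  ∑ σ ∈ Q n, ∏ v ∈ Finset.Icc 1 n, MvPolynomial.X (emptySlots σ v)

/-- The derivation that fills an empty slot with a new letter all of whose slots are empty. -/
noncomputable def slotDerivation :
    Derivation ℝ (MvPolynomial (Finset (Fin 3)) ℝ) (MvPolynomial (Finset (Fin 3)) ℝ) :=
  MvPolynomial.mkDerivation ℝ fun E =>
    ∑ s ∈ E, MvPolynomial.X Finset.univ * MvPolynomial.X (E.erase s)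

theorem Q_zero : Q 0 = {[]} := by
  ext σ
  rw [Finset.mem_singleton]
  refine ⟨fun h => List.length_eq_zero_iff.1 (length_of_mem_Q h), ?_⟩
  rintro rfl
  rw [mem_Q]
  refine ⟨fun a => ?_, fun j hj => ?_⟩
  · rw [if_neg (by omega), List.count_nil]
  · simp at hj

/-- The recursion has to start here, since the single gap of the empty word belongs to no letter. -/
theorem slotPoly_one : slotPoly 1 = MvPolynomial.X Finset.univ := by
  have h : ([] : List ℕ) ∈ Q 0 := by simp [Q_zero]
  rw [slotPoly, sum_Q_succ, Q_zero, Finset.sum_singleton, Finset.sum_range_one, zero_add,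
    Finset.Icc_self, Finset.prod_singleton]
  exact congrArg _ (emptySlots_insertPair_self h le_rfl)

/-- This turns a sum over insertion places into the double sum that the Leibniz rule produces. -/
theorem sum_gaps {M : Type*} [AddCommMonoid M] {n : ℕ} (hn : 1 ≤ n) {σ : List ℕ} (h : σ ∈ Q n)
    (f : ℕ × Fin 3 → M) :
    ∑ g ∈ Finset.range (2 * n + 1), f (kind σ g) =
      ∑ v ∈ Finset.Icc 1 n, ∑ s ∈ emptySlots σ v, f (v, s) := by
  rw [← Finset.sum_image (f := f) (kind_injOn hn h)]
  refine Finset.sum_finset_product' _ _ _ (f := fun v s => f (v, s)) ?_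
  rintro ⟨v, s⟩
  rw [Finset.mem_image, mem_emptySlots, Finset.mem_Icc, length_of_mem_Q h]
  constructor
  · rintro ⟨i, hi, hk⟩
    have hi' := Nat.lt_succ_iff.1 (Finset.mem_range.1 hi)
    have := kind_fst_mem hn h hi'
    rw [hk] at this
    exact ⟨this, i, hi', hk⟩
  · rintro ⟨_, i, hi, hk⟩
    exact ⟨i, Finset.mem_range.2 (Nat.lt_succ_of_le hi), hk⟩

theorem slotPoly_succ {n : ℕ} (hn : 1 ≤ n) : slotPoly (n + 1) = slotDerivation (slotPoly n) := by
  rw [slotPoly, slotPoly, sum_Q_succ, map_sum]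
  refine Finset.sum_congr rfl fun σ hσ => ?_
  rw [leibniz_finset_prod]
  simp only [slotDerivation, MvPolynomial.mkDerivation_X, Finset.mul_sum]
  rw [← sum_gaps hn hσ (fun x => (∏ j ∈ (Finset.Icc 1 n).erase x.1, MvPolynomial.X (emptySlots σ j)) *
    (MvPolynomial.X Finset.univ * MvPolynomial.X ((emptySlots σ x.1).erase x.2)))]
  refine Finset.sum_congr rfl fun g hg => ?_
  have hg' := Nat.lt_succ_iff.1 (Finset.mem_range.1 hg)
  have hk := kind_fst_mem hn hσ hg'
  rw [Finset.prod_Icc_succ_top (by omega), emptySlots_insertPair_self hσ hg',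
    ← Finset.prod_erase_mul _ _ (Finset.mem_Icc.2 hk),
    emptySlots_insertPair hσ hg' hk.1 hk.2, if_pos rfl, mul_assoc,
    mul_comm (MvPolynomial.X Finset.univ)]
  congr 1
  refine Finset.prod_congr rfl fun v hv => ?_
  rw [Finset.mem_erase, Finset.mem_Icc] at hv
  rw [emptySlots_insertPair hσ hg' hv.2.1 hv.2.2, if_neg hv.1]

/-- The generating polynomial of increasing plane trees by the degrees of the vertices. -/
noncomputable def degreePoly (n : ℕ) : MvPolynomial ℕ ℝ :=
  ∑ c ∈ increasingChildren n, ∏ v ∈ Finset.range n, MvPolynomial.X (c v).length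

/-- The derivation that gives a vertex a new child. -/
noncomputable def degreeDerivation : Derivation ℝ (MvPolynomial ℕ ℝ) (MvPolynomial ℕ ℝ) :=
  MvPolynomial.mkDerivation ℝ fun d => (d + 1) • (MvPolynomial.X 0 * MvPolynomial.X (d + 1))

theorem degreePoly_one : degreePoly 1 = MvPolynomial.X 0 := by
  simp [degreePoly, increasingChildren_one]

theorem degreePoly_succ {n : ℕ} (hn : 1 ≤ n) :
    degreePoly (n + 1) = degreeDerivation (degreePoly n) := by
  rw [degreePoly, degreePoly, sum_increasingChildren_succ hn, map_sum]
  refine Finset.sum_congr rfl fun c hc => ?_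
  rw [leibniz_finset_prod]
  refine Finset.sum_congr rfl fun v hv => ?_
  have hv' := Finset.mem_range.1 hv
  rw [degreeDerivation, MvPolynomial.mkDerivation_X, mul_smul_comm]
  -- The degrees do not depend on where among its siblings the leaf goes, so all positions
  -- contribute equally; their number is the coefficient d+1.
  refine (Finset.sum_eq_card_nsmul fun p _ => ?_).trans (by rw [Finset.card_range])
  rw [Finset.prod_range_succ, length_insertLeaf, if_neg (by omega),
    (mem_increasingChildren.1 hc).eq_nil (Nat.le_succ n), List.length_nil,
    ← Finset.prod_erase_mul _ _ hv, length_insertLeaf, if_pos rfl, mul_assoc,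
    mul_comm (MvPolynomial.X 0)]
  congr 1
  refine Finset.prod_congr rfl fun u hu => ?_
  rw [length_insertLeaf, if_neg (Finset.ne_of_mem_erase hu)]

/-- Embed a vertex of degree `d` into three slots in all possible ways. -/
noncomputable def embedSlots : MvPolynomial ℕ ℝ →ₐ[ℝ] MvPolynomial (Finset (Fin 3)) ℝ :=
  MvPolynomial.aeval fun d => ∑ E : Finset (Fin 3) with E.card + d = 3, MvPolynomial.X E

theorem embedSlots_X (d : ℕ) : embedSlots (MvPolynomial.X d) =
    ∑ E : Finset (Fin 3) with E.card + d = 3, MvPolynomial.X E := by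
  rw [embedSlots, MvPolynomial.aeval_X]

theorem embedSlots_X_zero : embedSlots (MvPolynomial.X 0) = MvPolynomial.X Finset.univ := by
  rw [embedSlots_X, show Finset.univ.filter (fun E : Finset (Fin 3) => E.card + 0 = 3) =
    {Finset.univ} by decide, Finset.sum_singleton]

theorem slotDerivation_embedSlots_X (d : ℕ) :
    slotDerivation (embedSlots (MvPolynomial.X d)) =
      embedSlots (degreeDerivation (MvPolynomial.X d)) := by
  rw [degreeDerivation, MvPolynomial.mkDerivation_X, map_nsmul, map_mul, embedSlots_X_zero,
    embedSlots_X, embedSlots_X, map_sum, Finset.mul_sum, Finset.smul_sum]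
  simp only [slotDerivation, MvPolynomial.mkDerivation_X]
  -- The factor d+1 is written as a sum over the d+1 elements outside `F`, so that (E, s) with s ∈ E
  -- can be matched with (E∖s, s).
  have h : ∀ F ∈ Finset.univ.filter (fun E : Finset (Fin 3) => E.card + (d + 1) = 3),
      (d + 1) • ((MvPolynomial.X Finset.univ : MvPolynomial (Finset (Fin 3)) ℝ) *
        MvPolynomial.X F) = ∑ _s ∈ Fᶜ, MvPolynomial.X Finset.univ * MvPolynomial.X F := by
    intro F hF
    have := (Finset.mem_filter.1 hF).2
    rw [Finset.sum_const, Finset.card_compl, Fintype.card_fin,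
      show 3 - F.card = d + 1 by omega]
  rw [Finset.sum_congr rfl h, Finset.sum_sigma', Finset.sum_sigma']
  refine Finset.sum_bij' (fun x _ => ⟨x.1.erase x.2, x.2⟩) (fun x _ => ⟨insert x.2 x.1, x.2⟩)
    ?_ ?_ ?_ ?_ ?_
  · rintro ⟨E, s⟩ hx
    simp only [Finset.mem_sigma, Finset.mem_filter, Finset.mem_univ, true_and, Finset.mem_compl,
      Finset.notMem_erase, not_false_eq_true, and_true] at hx ⊢
    have := Finset.card_erase_add_one hx.2
    omega
  · rintro ⟨E, s⟩ hx
    simp only [Finset.mem_sigma, Finset.mem_filter, Finset.mem_univ, true_and, Finset.mem_compl,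
      Finset.mem_insert_self, and_true] at hx ⊢
    have := Finset.card_insert_of_notMem hx.2
    omega
  · rintro ⟨E, s⟩ hx
    simp only [Finset.mem_sigma] at hx
    simp only [Finset.insert_erase hx.2]
  · rintro ⟨E, s⟩ hx
    simp only [Finset.mem_sigma, Finset.mem_compl] at hx
    simp only [Finset.erase_insert hx.2]
  · rintro ⟨E, s⟩ _
    rfl

theorem slotDerivation_embedSlots (p : MvPolynomial ℕ ℝ) :
    slotDerivation (embedSlots p) = embedSlots (degreeDerivation p) := by
  induction p using MvPolynomial.induction_on with
  | C a => rw [MvPolynomial.derivation_C, map_zero, ← MvPolynomial.algebraMap_eq,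
      AlgHom.commutes, Derivation.map_algebraMap]
  | add p q hp hq => simp only [map_add, hp, hq]
  | mul_X p d hp =>
    simp only [map_mul, Derivation.leibniz, map_add, smul_eq_mul, hp, slotDerivation_embedSlots_X]

theorem slotPoly_eq_embedSlots_degreePoly {n : ℕ} (hn : 1 ≤ n) :
    slotPoly n = embedSlots (degreePoly n) := by
  induction n, hn using Nat.le_induction with
  | base => rw [slotPoly_one, degreePoly_one, embedSlots_X_zero]
  | succ n hn ih => rw [slotPoly_succ hn, degreePoly_succ hn, ih, slotDerivation_embedSlots]

/-! ### Specialization -/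

/-- The contribution to `N` of a letter with set `E` of empty slots. -/
noncomputable def slotWeight (E : Finset (Fin 3)) : MvPolynomial (Fin 3) ℝ :=
  (if 0 ∈ E ∧ 1 ∈ E then MvPolynomial.X 0 else 1) *
    (if 0 ∈ E ∧ 2 ∈ E then MvPolynomial.X 1 else 1) *
    (if 1 ∈ E ∧ 2 ∈ E then MvPolynomial.X 2 else 1)

/-- Each statistic counts letters by a condition on their empty slots, so its monomial factors over
the letters. -/
theorem N_eq_aeval_slotPoly (n : ℕ) : N n = MvPolynomial.aeval slotWeight (slotPoly n) := by
  rw [N, slotPoly, map_sum]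
  refine Finset.sum_congr rfl fun σ hσ => ?_
  simp only [map_prod, MvPolynomial.aeval_X, slotWeight, Finset.prod_mul_distrib,
    Finset.prod_ite, Finset.prod_const, one_pow, mul_one]
  rw [lap_eq_card hσ, eud_eq_card hσ, rpd_eq_card hσ]

/-- The contribution of a vertex of degree `d`. -/
noncomputable def degreeWeight (d : ℕ) : MvPolynomial (Fin 3) ℝ :=
  ∑ E : Finset (Fin 3) with E.card + d = 3, slotWeight E

/-- The product form makes a product over all vertices split into powers whose exponents are degree
counts. -/
theorem degreeWeight_eq {d : ℕ} (hd : d ≤ 3) : degreeWeight d =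
    (if d = 2 then 3 else 1) *
    (if d = 1 then MvPolynomial.X 0 + MvPolynomial.X 1 + MvPolynomial.X 2 else 1) *
    (if d = 0 then MvPolynomial.X 0 * MvPolynomial.X 1 * MvPolynomial.X 2 else 1) := by
  unfold degreeWeight
  interval_cases d
  · rw [show Finset.univ.filter (fun E : Finset (Fin 3) => E.card + 0 = 3) = {Finset.univ} by
      decide, Finset.sum_singleton]
    simp [slotWeight]
  · rw [show Finset.univ.filter (fun E : Finset (Fin 3) => E.card + 1 = 3) =
      {{0, 1}, {0, 2}, {1, 2}} by decide, Finset.sum_insert (by decide),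
      Finset.sum_insert (by decide), Finset.sum_singleton]
    simp [slotWeight, add_assoc]
  · rw [show Finset.univ.filter (fun E : Finset (Fin 3) => E.card + 2 = 3) =
      {{0}, {1}, {2}} by decide, Finset.sum_insert (by decide),
      Finset.sum_insert (by decide), Finset.sum_singleton]
    simp [slotWeight]
    norm_num
  · rw [show Finset.univ.filter (fun E : Finset (Fin 3) => E.card + 3 = 3) = {∅} by decide,
      Finset.sum_singleton]
    simp [slotWeight]

/-- This is what restricts the sum to 0-1-2-3 trees: a letter has only three slots to fill. -/
theorem degreeWeight_eq_zero {d : ℕ} (hd : 3 < d) : degreeWeight d = 0 := by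
  unfold degreeWeight
  rw [Finset.filter_eq_empty_iff.2 (fun E _ => by omega), Finset.sum_empty]

theorem N_eq_sum_increasingChildren {n : ℕ} (hn : 1 ≤ n) :
    N n = ∑ c ∈ increasingChildren n, ∏ v ∈ Finset.range n, degreeWeight (c v).length := by
  rw [N_eq_aeval_slotPoly, slotPoly_eq_embedSlots_degreePoly hn, degreePoly]
  simp only [map_sum, map_prod, embedSlots_X, MvPolynomial.aeval_X, degreeWeight]

/-! ### Grouping trees by their degree sequence -/

/-- The number of vertices of degree `d` of a child function. -/
def numLength (n : ℕ) (c : ℕ → List ℕ) (d : ℕ) : ℕ :=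
  ((Finset.range n).filter fun v => (c v).length = d).card

theorem PlaneTree.numLength_natChildren {n : ℕ} (T : PlaneTree (Fin n)) (d : ℕ) :
    numLength n T.natChildren d = T.numDegree d := by
  unfold numLength PlaneTree.numDegree
  refine (Finset.card_bij (fun (v : Fin n) _ => (v : ℕ)) ?_ (fun _ _ _ _ h => Fin.ext h) ?_).symm
  · intro v hv
    rw [Finset.mem_filter] at hv
    rw [Finset.mem_filter, Finset.mem_range, T.length_natChildren]
    exact ⟨v.2, hv.2⟩
  · intro v hv
    rw [Finset.mem_filter, Finset.mem_range] at hv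
    refine ⟨⟨v, hv.1⟩, ?_, rfl⟩
    rw [Finset.mem_filter, ← T.length_natChildren]
    exact ⟨Finset.mem_univ _, hv.2⟩

theorem IsIncreasingChildren.sum_length {n : ℕ} (hn : 1 ≤ n) {c : ℕ → List ℕ}
    (h : IsIncreasingChildren n c) : ∑ v ∈ Finset.range n, (c v).length + 1 = n := by
  induction n, hn using Nat.le_induction generalizing c with
  | base => simp [h.eq_of_le_one le_rfl]
  | succ n hn ih =>
    obtain ⟨c, hc, v, hv, p, hp, rfl⟩ := h.exists_insertLeaf_eq hn
    have key : ∀ u, (StirlingPerm.insertLeaf n c v p u).length =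
        (c u).length + if u = v then 1 else 0 := by
      intro u
      rw [length_insertLeaf]
      split_ifs <;> rfl
    have := ih hc
    rw [Finset.sum_range_succ, key, if_neg (by omega), hc.eq_nil (Nat.le_succ n)]
    simp only [key, Finset.sum_add_distrib, Finset.sum_ite_eq', Finset.mem_range, hv, if_true,
      List.length_nil]
    omega

theorem IsIncreasingChildren.numLength_relation {n : ℕ} (hn : 1 ≤ n) {c : ℕ → List ℕ}
    (h : IsIncreasingChildren n c) (h3 : ∀ v ∈ Finset.range n, (c v).length ≤ 3) :
    numLength n c 2 + 2 * numLength n c 1 + 3 * numLength n c 0 = 2 * n + 1 := by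
  have h1 := h.sum_length hn
  -- Each vertex contributes 3 - d to the counts and d to the degree sum. The degrees add up to n-1,
  -- which leaves 3n - (n-1) = 2n+1.
  have h2 : numLength n c 2 + 2 * numLength n c 1 + 3 * numLength n c 0 +
      ∑ v ∈ Finset.range n, (c v).length = ∑ v ∈ Finset.range n, 3 := by
    simp only [numLength, Finset.card_filter, Finset.mul_sum, ← Finset.sum_add_distrib]
    refine Finset.sum_congr rfl fun v hv => ?_
    have := h3 v hv
    generalize (c v).length = d at this
    interval_cases d <;> rfl
  rw [Finset.sum_const, Finset.card_range, smul_eq_mul] at h2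
  omega

theorem gam_eq_card {n : ℕ} (hn : 1 ≤ n) (i j k : ℕ) :
    gam n i j k = ((increasingChildren n).filter fun c =>
      (∀ v ∈ Finset.range n, (c v).length ≤ 3) ∧
        (numLength n c 2, numLength n c 1, numLength n c 0) = (i, j, k)).card := by
  rw [gam, ← Set.ncard_coe_finset, ← Set.InjOn.ncard_image
    (f := PlaneTree.natChildren) fun T hT T' hT' => PlaneTree.natChildren_injective hT.1 hT'.1]
  congr 1
  ext c
  simp only [Set.mem_image, Finset.coe_filter, Set.mem_ofPred_eq, mem_increasingChildren,
    Prod.mk.injEq, trees0123]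
  constructor
  · rintro ⟨T, ⟨hT, h3, h0, h1, h2⟩, rfl⟩
    simp only [PlaneTree.numLength_natChildren]
    refine ⟨PlaneTree.isIncreasingChildren_natChildren hT, fun v hv => ?_, h2, h1, h0⟩
    exact (T.length_natChildren ⟨v, Finset.mem_range.1 hv⟩).trans_le (h3 _)
  · rintro ⟨hc, h3, h2, h1, h0⟩
    obtain ⟨T, hT, rfl⟩ := PlaneTree.exists_natChildren_eq hn hc
    simp only [PlaneTree.numLength_natChildren] at h2 h1 h0
    refine ⟨T, ⟨hT, fun v => ?_, h0, h1, h2⟩, rfl⟩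
    exact (T.length_natChildren v).symm.trans_le (h3 v (Finset.mem_range.2 v.2))

theorem prod_degreeWeight {n : ℕ} {c : ℕ → List ℕ}
    (h3 : ∀ v ∈ Finset.range n, (c v).length ≤ 3) :
    ∏ v ∈ Finset.range n, degreeWeight (c v).length =
      3 ^ numLength n c 2 *
        (MvPolynomial.X 0 + MvPolynomial.X 1 + MvPolynomial.X 2) ^ numLength n c 1 *
        (MvPolynomial.X 0 * MvPolynomial.X 1 * MvPolynomial.X 2) ^ numLength n c 0 := by
  rw [Finset.prod_congr rfl fun v hv => degreeWeight_eq (h3 v hv)]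
  simp only [Finset.prod_mul_distrib (s := Finset.range n), Finset.prod_ite, Finset.prod_const,
    one_pow, mul_one, numLength]

theorem N_eq_sum_triples {n : ℕ} (hn : 1 ≤ n) :
    N n = ∑ t ∈ triples (2 * n + 1),
      ((3 ^ t.1 * gam n t.1 t.2.1 t.2.2 : ℕ) : MvPolynomial (Fin 3) ℝ) *
        (MvPolynomial.X 0 + MvPolynomial.X 1 + MvPolynomial.X 2) ^ t.2.1 *
        (MvPolynomial.X 0 * MvPolynomial.X 1 * MvPolynomial.X 2) ^ t.2.2 := by
  have h1 : N n = ∑ c ∈ (increasingChildren n).filter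
      (fun c => ∀ v ∈ Finset.range n, (c v).length ≤ 3),
        ∏ v ∈ Finset.range n, degreeWeight (c v).length := by
    rw [N_eq_sum_increasingChildren hn]
    refine (Finset.sum_filter_of_ne fun c _ hne => ?_).symm
    by_contra! h
    obtain ⟨v, hv, h⟩ := h
    exact hne (Finset.prod_eq_zero hv (degreeWeight_eq_zero h))
  -- The trees are grouped by their degree counts; the summand is constant on each fibre, whose size
  -- is `gam`.
  rw [h1, ← Finset.sum_fiberwise_of_maps_to
    (g := fun c => (numLength n c 2, numLength n c 1, numLength n c 0)) (t := triples (2 * n + 1))]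
  · refine Finset.sum_congr rfl fun t _ => ?_
    rw [gam_eq_card hn, Finset.filter_filter]
    refine (Finset.sum_eq_card_nsmul (b := 3 ^ t.1 *
      (MvPolynomial.X 0 + MvPolynomial.X 1 + MvPolynomial.X 2) ^ t.2.1 *
        (MvPolynomial.X 0 * MvPolynomial.X 1 * MvPolynomial.X 2) ^ t.2.2) fun c hc => ?_).trans ?_
    · obtain ⟨-, h3, rfl⟩ := Finset.mem_filter.1 hc
      exact prod_degreeWeight h3
    · rw [nsmul_eq_mul]
      push_cast
      ring
  · intro c hc
    rw [Finset.mem_filter, mem_increasingChildren] at hc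
    have := hc.1.numLength_relation hn hc.2
    simp only [triples, Finset.mem_filter, Finset.mem_product, Finset.mem_range]
    omega

/-! ### `e`-positivity -/

/-- The partition of `j + 3 k` into `j` parts `1` and `k` parts `3`. -/
def onesThrees (j k : ℕ) : (j + 3 * k).Partition where
  parts := Multiset.replicate j 1 + Multiset.replicate k 3
  parts_pos := by
    intro i hi
    rcases Multiset.mem_add.1 hi with h | h <;> rw [Multiset.eq_of_mem_replicate h] <;> norm_num
  parts_sum := by
    simp [Multiset.sum_replicate, mul_comm]

theorem esymmPart_onesThrees (j k : ℕ) :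
    MvPolynomial.esymmPart (Fin 3) ℝ (onesThrees j k) =
      (MvPolynomial.X 0 + MvPolynomial.X 1 + MvPolynomial.X 2) ^ j *
        (MvPolynomial.X 0 * MvPolynomial.X 1 * MvPolynomial.X 2) ^ k := by
  have h1 : MvPolynomial.esymm (Fin 3) ℝ 1 =
      MvPolynomial.X 0 + MvPolynomial.X 1 + MvPolynomial.X 2 := by
    rw [MvPolynomial.esymm_one, Fin.sum_univ_three]
  have h3 : MvPolynomial.esymm (Fin 3) ℝ 3 =
      MvPolynomial.X 0 * MvPolynomial.X 1 * MvPolynomial.X 2 := by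
    rw [MvPolynomial.esymm, show Finset.powersetCard 3 (Finset.univ : Finset (Fin 3)) =
      {Finset.univ} by decide, Finset.sum_singleton, Fin.prod_univ_three]
  simp only [MvPolynomial.esymmPart, onesThrees, Multiset.map_add, Multiset.map_replicate,
    Multiset.prod_add, Multiset.prod_replicate, h1, h3]

theorem isSymmetric_esymmPart {ι : Type*} [Fintype ι] {m : ℕ} (μ : m.Partition) :
    (MvPolynomial.esymmPart ι ℝ μ).IsSymmetric := by
  intro e
  rw [MvPolynomial.esymmPart, map_multiset_prod, Multiset.map_map]
  congr 1
  exact Multiset.map_congr rfl fun i _ => MvPolynomial.esymm_isSymmetric ι ℝ i e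

theorem ePositive_sum_esymmPart {ι α : Type*} [Fintype ι] (s : Finset α) (a : α → ℝ)
    (ha : ∀ t ∈ s, 0 ≤ a t) (μ : α → Σ m : ℕ, m.Partition) :
    EPositive (∑ t ∈ s, a t • MvPolynomial.esymmPart ι ℝ (μ t).2) := by
  classical
  -- The map `μ` need not be injective: coefficients of coinciding partitions add up and stay
  -- nonnegative.
  refine ⟨fun e => ?_, ∑ t ∈ s, Finsupp.single (μ t) (a t), fun ν => ?_, ?_⟩
  · rw [map_sum]
    refine Finset.sum_congr rfl fun t _ => ?_
    rw [map_smul, isSymmetric_esymmPart (μ t).2 e]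
  · rw [Finsupp.finsetSum_apply]
    refine Finset.sum_nonneg fun t ht => ?_
    rw [Finsupp.single_apply]
    split_ifs
    · exact ha t ht
    · exact le_rfl
  · rw [← Finsupp.sum_finsetSum_index
      (h := fun (ν : Σ m : ℕ, m.Partition) b => b • MvPolynomial.esymmPart ι ℝ ν.2)
      (fun _ => zero_smul _ _) (fun _ _ _ => add_smul _ _ _)]
    refine Finset.sum_congr rfl fun t _ => ?_
    exact (Finsupp.sum_single_index (h := fun (ν : Σ m : ℕ, m.Partition) b =>
      b • MvPolynomial.esymmPart ι ℝ ν.2) (zero_smul ℝ _)).symm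

theorem ePositive_N {n : ℕ} (hn : 1 ≤ n) : EPositive (N n) := by
  have := ePositive_sum_esymmPart (ι := Fin 3) (triples (2 * n + 1))
    (fun t => ((3 ^ t.1 * gam n t.1 t.2.1 t.2.2 : ℕ) : ℝ)) (fun _ _ => Nat.cast_nonneg _)
    (fun t => ⟨_, onesThrees t.2.1 t.2.2⟩)
  convert this using 1
  rw [N_eq_sum_triples hn]
  refine Finset.sum_congr rfl fun t _ => ?_
  rw [esymmPart_onesThrees, mul_assoc, Nat.cast_smul_eq_nsmul, nsmul_eq_mul]

end StirlingPerm

theorem mainTheorem2 (n : ℕ) (hn : 1 ≤ n) :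
    StirlingPerm.N n =
        ∑ t ∈ StirlingPerm.triples (2 * n + 1),
          ((3 ^ t.1 * StirlingPerm.gam n t.1 t.2.1 t.2.2 : ℕ) : MvPolynomial (Fin 3) ℝ) *
            (MvPolynomial.X 0 + MvPolynomial.X 1 + MvPolynomial.X 2) ^ t.2.1 *
            (MvPolynomial.X 0 * MvPolynomial.X 1 * MvPolynomial.X 2) ^ t.2.2 ∧
      StirlingPerm.EPositive (StirlingPerm.N n) :=
  ⟨StirlingPerm.N_eq_sum_triples hn, StirlingPerm.ePositive_N hn⟩
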